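/- Let $\mathbb T=\mathbb R/2\pi\mathbb Z$, $\alpha\in\mathbb R$, $q\in\mathbb N$, and let $Q=(Q_0,\dots,Q_{q-1})$ with $Q_j:\mathbb T\to\mathbb R$ continuous. For $\psi_0\in L^2(\mathbb T;\mathbb C)$, $\tau>0$ and a piecewise constant control $u:(0,\tau)\to\mathbb R^q$, let $R_t(\psi_0,u)$, $t\in[0,\tau]$, be the value at time $t$ of the (unique, mild) solution in $C([0,\tau];L^2(\mathbb T;\mathbb C))$ of $$\partial_t\psi+\partial_x^3\psi-i\alpha\,\partial_x^2\psi=i\,(u(t)\cdot Q(x))\,\psi,\qquad \psi(0,\cdot)=\psi_0,$$ that is, with $L=-\partial_x^3+i\alpha\partial_x^2$, $$\psi(t)=e^{tL}\psi_0+\int_0^t e^{(t-s)L}\,i\,(u(s)\cdot Q)\,\psi(s)\,ds,\qquad t\in[0,\tau].$$ Let $\mathcal A$ be the set of all $\theta\in L^2(\mathbb T;\mathbb R)$ such that for every $\psi_0\in L^2(\mathbb T;\mathbb C)$, $T>0$ and $\varepsilon>0$ there exist $\tau\in(0,T)$ and a piecewise constant control $u:(0,\tau)\to\mathbb R^q$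 with $$\|R_\tau(\psi_0,u)-e^{i\theta}\psi_0\|_{L^2}\le\varepsilon .$$ **Proposition.** Let $\varphi\in C^3(\mathbb T;\mathbb R)$ and assume that the real span $\{c\varphi : c\in\mathbb R\}$ of $\varphi$ is contained in $\mathcal A$. Then $(\varphi')^3\in\mathcal A$. -/

import Mathlib

open MeasureTheory AddCircle

noncomputable section

namespace KdVSch

instance fact_two_pi_pos : Fact (0 < 2 * Real.pi) := ⟨Real.two_pi_pos⟩

/-- The torus `ℝ / 2πℤ`. -/
abbrev Torus : Type := AddCircle (2 * Real.pi)

/-- Complex-valued `L²` on the torus, for the Lebesgue measure normalised to total mass one. -/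
abbrev L2C : Type := Lp ℂ 2 (haarAddCircle : Measure Torus)

/-- Real-valued `L²` on the torus. -/
abbrev L2R : Type := Lp ℝ 2 (haarAddCircle : Measure Torus)

/-- The Fourier multiplier of `exp (t L)` at the frequency `k`, where
`L = -∂ₓ³ + i α ∂ₓ²`: each `∂ₓ` is replaced by `i k`. -/
def symbol (α t : ℝ) (k : ℤ) : ℂ :=
  Complex.exp (t * (-(Complex.I * k) ^ 3 + Complex.I * α * (Complex.I * k) ^ 2))

theorem norm_symbol (α t : ℝ) (k : ℤ) : ‖symbol α t k‖ = 1 := by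
  have h : (t * (-(Complex.I * k) ^ 3 + Complex.I * α * (Complex.I * k) ^ 2) : ℂ)
      = ((t * ((k : ℝ) ^ 3 - α * (k : ℝ) ^ 2) : ℝ) : ℂ) * Complex.I := by
    push_cast
    linear_combination (t * (-Complex.I * k ^ 3 + Complex.I * α * k ^ 2) : ℂ) * Complex.I_sq
  rw [symbol, h, Complex.norm_exp_ofReal_mul_I]

theorem memlp_symbol_mul (α t : ℝ) (a : lp (fun _ : ℤ => ℂ) 2) :
    Memℓp (fun k : ℤ => symbol α t k * a k) 2 :=
  (lp.memℓp a).mono' (fun k => by rw [norm_mul, norm_symbol, one_mul])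

/-- The free group `exp (t L)` on `L²`, `L = -∂ₓ³ + i α ∂ₓ²`, in the Fourier basis
`x ↦ exp (i k x)`. -/
def freeFlow (α t : ℝ) (f : L2C) : L2C :=
  fourierBasis.repr.symm
    (⟨fun k : ℤ => symbol α t k * fourierBasis.repr f k,
      memlp_symbol_mul α t (fourierBasis.repr f)⟩ : lp (fun _ : ℤ => ℂ) 2)

theorem memLp_potential {q : ℕ} (Q : Fin q → C(Torus, ℝ)) (c : Fin q → ℝ) (f : L2C) :
    MemLp (fun x : Torus => Complex.I * ((∑ j, c j * Q j x : ℝ) : ℂ) * f x) 2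
      haarAddCircle := by
  have hc : Continuous (fun x : Torus => Complex.I * ((∑ j, c j * Q j x : ℝ) : ℂ)) := by
    fun_prop
  obtain ⟨C, hC⟩ := isCompact_univ.exists_bound_of_continuousOn hc.continuousOn
  refine (Lp.memLp f).of_le_mul (c := C)
    (hc.aestronglyMeasurable.mul (Lp.aestronglyMeasurable f)) ?_
  filter_upwards with x
  rw [norm_mul]
  exact mul_le_mul_of_nonneg_right (hC x (Set.mem_univ x)) (norm_nonneg _)

/-- The function `i (c · Q) f` for a control value `c ∈ ℝ^q`. -/
def potential {q : ℕ} (Q : Fin q → C(Torus, ℝ)) (c : Fin q → ℝ) (f : L2C) : L2C :=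
  (memLp_potential Q c f).toLp _

theorem memLp_phase (θ : L2R) (f : L2C) :
    MemLp (fun x : Torus => Complex.exp (Complex.I * (θ x : ℂ)) * f x) 2 haarAddCircle := by
  have hm : AEStronglyMeasurable (fun x : Torus => Complex.exp (Complex.I * (θ x : ℂ)))
      haarAddCircle :=
    (show Continuous fun y : ℝ => Complex.exp (Complex.I * (y : ℂ)) by
      fun_prop).comp_aestronglyMeasurable (Lp.aestronglyMeasurable θ)
  refine (Lp.memLp f).of_le (hm.mul (Lp.aestronglyMeasurable f)) ?_
  filter_upwards with x
  rw [norm_mul, mul_comm Complex.I, Complex.norm_exp_ofReal_mul_I, one_mul]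

/-- The function `exp (i θ) f`. -/
def phaseMul (θ : L2R) (f : L2C) : L2C :=
  (memLp_phase θ f).toLp _

/-- `u` is piecewise constant on `(0, τ)`: there is a finite set of breakpoints such that `u`
takes the same value at any two times that are not separated by (or equal to) a breakpoint. -/
def IsPWC {q : ℕ} (τ : ℝ) (u : ℝ → Fin q → ℝ) : Prop :=
  ∃ F : Finset ℝ, ∀ a ∈ Set.Ioo 0 τ, ∀ b ∈ Set.Ioo 0 τ, a ≤ b →
    Disjoint (Set.Icc a b) (F : Set ℝ) → u a = u b

/-- `ψ ∈ C([0, τ]; L²)` is the (mild) solution on `[0, τ]` of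
`∂ₜψ + ∂ₓ³ψ - i α ∂ₓ²ψ = i (u · Q) ψ`, `ψ(0) = ψ₀`, that is, it satisfies Duhamel's formula
`ψ(t) = exp(tL) ψ₀ + ∫₀ᵗ exp((t-s)L) (i (u(s) · Q) ψ(s)) ds` (a Bochner integral in `L²`). -/
structure IsSolution {q : ℕ} (α : ℝ) (Q : Fin q → C(Torus, ℝ)) (τ : ℝ)
    (u : ℝ → Fin q → ℝ) (ψ₀ : L2C) (ψ : ℝ → L2C) : Prop where
  continuousOn : ContinuousOn ψ (Set.Icc 0 τ)
  integrable : ∀ t ∈ Set.Icc 0 τ, IntervalIntegrable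
    (fun s : ℝ => freeFlow α (t - s) (potential Q (u s) (ψ s))) volume 0 t
  duhamel : ∀ t ∈ Set.Icc 0 τ, ψ t = freeFlow α t ψ₀ +
    ∫ s in (0 : ℝ)..t, freeFlow α (t - s) (potential Q (u s) (ψ s))

/-- The set `𝒜` of phases `θ ∈ L²(𝕋; ℝ)` such that `exp (i θ) ψ₀` can be approximately reached
from every `ψ₀` in arbitrarily small time. The solution for a given `ψ₀` and `u` is unique, so
that `ψ τ` below is its value at time `τ`. -/
def admissiblePhases {q : ℕ} (α : ℝ) (Q : Fin q → C(Torus, ℝ)) : Set L2R :=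
  {θ | ∀ ψ₀ : L2C, ∀ T > (0 : ℝ), ∀ ε > (0 : ℝ), ∃ τ ∈ Set.Ioo 0 T, ∃ u : ℝ → Fin q → ℝ,
    IsPWC τ u ∧ ∃ ψ : ℝ → L2C, IsSolution α Q τ u ψ₀ ψ ∧ ‖ψ τ - phaseMul θ ψ₀‖ ≤ ε}

/-- The derivative of a function on the torus. -/
def torusDeriv (f : Torus → ℝ) (x : Torus) : ℝ :=
  deriv (fun y : ℝ => f (x + (y : Torus))) 0

end KdVSch

end

open MeasureTheory AddCircle

noncomputable section

namespace KdVSch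

/-! Conjugate the free group by a large phase over a short time: as `m → 0⁺`, `e^{-iφ/m} e^{m³L}
e^{iφ/m}` converges strongly to `e^{i(φ')³}`. Indeed the derivatives in `m³L` that fall on
`e^{iφ/m}` give `-m³(iφ'/m)³ = i(φ')³`, and every other term carries a positive power of `m`. Both
phases `±φ/m` are admissible, so the three factors can be realised approximately in arbitrarily
small total time, the middle one with zero control (`mem_admissiblePhases_of_tendsto`).

All operators involved are isometries, so the limit need only be checked on `e_k = e^{ikx}`. There,
`G(s) = e^{i(φ/m + s w)} e_k` with `w` close to `(φ')³` is an explicit approximate solution of `∂ₛψ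
= m³Lψ` on `[0, 1]`. Its defect is of size `|w - (φ')³| + O(m)` (`eventually_norm_defect_le`), and
since the group is isometric the defect bounds the distance from `G(1)` to `e^{m³L}G(0)`
(`norm_freeFlow_neg_sub_le`). -/

/-! ### The free group and multiplication by phases, as isometries of `L²`. -/

theorem symbol_add (α s t : ℝ) (k : ℤ) : symbol α (s + t) k = symbol α s k * symbol α t k := by
  rw [symbol, symbol, symbol, ← Complex.exp_add]
  push_cast
  ring_nf

theorem symbol_zero (α : ℝ) (k : ℤ) : symbol α 0 k = 1 := by simp [symbol]

theorem continuous_symbol (α : ℝ) (k : ℤ) : Continuous fun t => symbol α t k := by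
  unfold symbol
  fun_prop

theorem repr_freeFlow (α t : ℝ) (f : L2C) (k : ℤ) :
    fourierBasis.repr (freeFlow α t f) k = symbol α t k * fourierBasis.repr f k := by
  simp [freeFlow]

theorem L2C.ext_repr {f g : L2C} (h : ∀ k : ℤ, fourierBasis.repr f k = fourierBasis.repr g k) :
    f = g :=
  fourierBasis.repr.injective (lp.ext (funext h))

theorem norm_freeFlow (α t : ℝ) (f : L2C) : ‖freeFlow α t f‖ = ‖f‖ := by
  rw [← fourierBasis.repr.norm_map f, ← fourierBasis.repr.norm_map (freeFlow α t f),
    lp.norm_eq_tsum_rpow (by norm_num), lp.norm_eq_tsum_rpow (by norm_num)]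
  simp only [repr_freeFlow, norm_mul, norm_symbol, one_mul]

/-- The free flow at time `t` as a linear isometry of `L²`. -/
def freeFlowIsometry (α t : ℝ) : L2C →ₗᵢ[ℂ] L2C where
  toFun := freeFlow α t
  map_add' f g := L2C.ext_repr fun k => by simp [repr_freeFlow, mul_add]
  map_smul' c f := L2C.ext_repr fun k => by simp [repr_freeFlow, mul_left_comm]
  norm_map' := norm_freeFlow α t

@[simp]
theorem freeFlowIsometry_apply (α t : ℝ) (f : L2C) : freeFlowIsometry α t f = freeFlow α t f := rfl

theorem freeFlow_add (α s t : ℝ) (f : L2C) :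
    freeFlow α (s + t) f = freeFlow α s (freeFlow α t f) :=
  L2C.ext_repr fun k => by simp [repr_freeFlow, symbol_add, mul_assoc]

theorem freeFlow_zero (α : ℝ) (f : L2C) : freeFlow α 0 f = f :=
  L2C.ext_repr fun k => by simp [repr_freeFlow, symbol_zero]

theorem freeFlow_fourierBasis (α t : ℝ) (k : ℤ) :
    freeFlow α t (fourierBasis k) = symbol α t k • fourierBasis k := by
  refine L2C.ext_repr fun j => ?_
  rw [repr_freeFlow, map_smul, lp.coeFn_smul, Pi.smul_apply, smul_eq_mul,
    HilbertBasis.repr_self, lp.single_apply]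
  by_cases h : j = k
  · subst h; rfl
  · simp [h]

/-- Pointwise convergence of linear isometries of `L²` can be checked on the Fourier basis. -/
theorem tendsto_isometry_of_fourierBasis {ι : Type*} {l : Filter ι} (A : ι → L2C →ₗᵢ[ℂ] L2C)
    (B : L2C →ₗᵢ[ℂ] L2C)
    (h : ∀ k : ℤ, Filter.Tendsto (fun i => A i (fourierBasis k)) l (nhds (B (fourierBasis k))))
    (f : L2C) : Filter.Tendsto (fun i => A i f) l (nhds (B f)) := by
  have hspan : ∀ g ∈ Submodule.span ℂ (Set.range fun k : ℤ => (fourierBasis k : L2C)),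
      Filter.Tendsto (fun i => A i g) l (nhds (B g)) := by
    intro g hg
    induction hg using Submodule.span_induction with
    | mem x hx => obtain ⟨k, rfl⟩ := hx; exact h k
    | zero => simp [tendsto_const_nhds]
    | add x y _ _ hx hy => simpa using hx.add hy
    | smul c x _ hx => simpa using hx.const_smul c
  have hd : f ∈ closure
      (Submodule.span ℂ (Set.range fun k : ℤ => (fourierBasis k : L2C)) : Set L2C) := by
    rw [← Submodule.topologicalClosure_coe, fourierBasis.dense_span]
    trivial
  rw [Metric.tendsto_nhds]
  intro ε hε
  obtain ⟨g, hg, hfg⟩ := Metric.mem_closure_iff.1 hd (ε / 3) (by positivity)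
  filter_upwards [Metric.tendsto_nhds.1 (hspan g hg) (ε / 3) (by positivity)] with i hi
  have h1 : dist (A i f) (A i g) < ε / 3 := by rwa [(A i).isometry.dist_eq]
  have h2 : dist (B g) (B f) < ε / 3 := by rwa [B.isometry.dist_eq, dist_comm]
  linarith [dist_triangle4 (A i f) (A i g) (B g) (B f)]

theorem continuous_freeFlow (α : ℝ) (f : L2C) : Continuous fun t => freeFlow α t f := by
  refine continuous_iff_continuousAt.2 fun t => ?_
  refine tendsto_isometry_of_fourierBasis (fun s => freeFlowIsometry α s)
    (freeFlowIsometry α t) (fun k => ?_) f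
  simp only [freeFlowIsometry_apply, freeFlow_fourierBasis]
  exact ((continuous_symbol α k).tendsto t).smul_const _

theorem coeFn_phaseMul (θ : L2R) (f : L2C) :
    phaseMul θ f =ᵐ[haarAddCircle] fun x => Complex.exp (Complex.I * (θ x : ℂ)) * f x :=
  MemLp.coeFn_toLp _

/-- Multiplication by `exp (i θ)` as a linear isometry of `L²`. -/
def phaseIsometry (θ : L2R) : L2C →ₗᵢ[ℂ] L2C where
  toFun := phaseMul θ
  map_add' f g := Lp.ext <| by
    filter_upwards [coeFn_phaseMul θ (f + g), coeFn_phaseMul θ f, coeFn_phaseMul θ g,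
      Lp.coeFn_add f g, Lp.coeFn_add (phaseMul θ f) (phaseMul θ g)] with x h1 h2 h3 h4 h5
    rw [h1, h5, h4, Pi.add_apply, Pi.add_apply, h2, h3, mul_add]
  map_smul' c f := Lp.ext <| by
    filter_upwards [coeFn_phaseMul θ (c • f), coeFn_phaseMul θ f,
      Lp.coeFn_smul c f, Lp.coeFn_smul c (phaseMul θ f)] with x h1 h2 h3 h4
    rw [h1, RingHom.id_apply, h4, h3, Pi.smul_apply, Pi.smul_apply, h2, smul_eq_mul, smul_eq_mul,
      mul_left_comm]
  norm_map' f := by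
    change ‖phaseMul θ f‖ = ‖f‖
    refine le_antisymm (Lp.norm_le_norm_of_ae_le ?_) (Lp.norm_le_norm_of_ae_le ?_) <;>
    · filter_upwards [coeFn_phaseMul θ f] with x h
      rw [h, norm_mul, mul_comm Complex.I, Complex.norm_exp_ofReal_mul_I, one_mul]

@[simp]
theorem phaseIsometry_apply (θ : L2R) (f : L2C) : phaseIsometry θ f = phaseMul θ f := rfl

theorem phaseMul_neg_phaseMul (θ : L2R) (f : L2C) : phaseMul (-θ) (phaseMul θ f) = f :=
  Lp.ext <| by
    filter_upwards [coeFn_phaseMul (-θ) (phaseMul θ f), coeFn_phaseMul θ f, Lp.coeFn_neg θ]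
      with x h1 h2 h3
    rw [h1, h2, h3, ← mul_assoc, ← Complex.exp_add]
    simp

/-- The continuous function `exp (i θ)`. -/
def expPhase (θ : C(Torus, ℝ)) : C(Torus, ℂ) where
  toFun x := Complex.exp (Complex.I * (θ x : ℂ))

theorem expPhase_apply (θ : C(Torus, ℝ)) (x : Torus) :
    expPhase θ x = Complex.exp (Complex.I * (θ x : ℂ)) := rfl

theorem expPhase_zero : expPhase 0 = 1 := by
  ext x
  simp [expPhase_apply]

theorem norm_expPhase_apply (θ : C(Torus, ℝ)) (x : Torus) : ‖expPhase θ x‖ = 1 := by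
  rw [expPhase_apply, mul_comm, Complex.norm_exp_ofReal_mul_I]

/-- The class in `L²(𝕋; ℂ)` of a continuous function. -/
abbrev toL2C : C(Torus, ℂ) →L[ℂ] L2C := ContinuousMap.toLp 2 haarAddCircle ℂ

/-- The class in `L²(𝕋; ℝ)` of a continuous function. -/
abbrev toL2R : C(Torus, ℝ) →L[ℝ] L2R := ContinuousMap.toLp 2 haarAddCircle ℝ

theorem phaseMul_toL2R (θ : C(Torus, ℝ)) (f : C(Torus, ℂ)) :
    phaseMul (toL2R θ) (toL2C f) = toL2C (expPhase θ * f) :=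
  Lp.ext <| by
    filter_upwards [coeFn_phaseMul (toL2R θ) (toL2C f),
      ContinuousMap.coeFn_toLp (p := 2) (𝕜 := ℝ) haarAddCircle θ,
      ContinuousMap.coeFn_toLp (p := 2) (𝕜 := ℂ) haarAddCircle f,
      ContinuousMap.coeFn_toLp (p := 2) (𝕜 := ℂ) haarAddCircle (expPhase θ * f)] with x h1 h2 h3 h4
    rw [h1, h2, h3, h4, ContinuousMap.mul_apply, expPhase_apply]

theorem norm_toL2C_le {f : C(Torus, ℂ)} {C : ℝ} (hC : ∀ x, ‖f x‖ ≤ C) : ‖toL2C f‖ ≤ C := by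
  have h : ∀ᵐ x ∂haarAddCircle, ‖toL2C f x‖ ≤ C := by
    filter_upwards [ContinuousMap.coeFn_toLp (p := 2) (𝕜 := ℂ) haarAddCircle f] with x hx
    rw [hx]
    exact hC x
  simpa [measureUnivNNReal] using Lp.norm_le_of_ae_bound ((norm_nonneg _).trans (hC 0)) h

theorem potential_zero {q : ℕ} (Q : Fin q → C(Torus, ℝ)) (f : L2C) : potential Q 0 f = 0 :=
  Lp.ext <| by
    filter_upwards [MemLp.coeFn_toLp (memLp_potential Q 0 f), Lp.coeFn_zero ℂ 2 haarAddCircle]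
      with x h1 h2
    rw [potential, h1, h2]
    simp

/-! ### Concatenation of controls and of mild solutions. -/

/-- The function equal to `f` up to time `a` and to `g`, restarted at time `a`, afterwards. -/
def concat {X : Type*} (a : ℝ) (f g : ℝ → X) (s : ℝ) : X :=
  if s ≤ a then f s else g (s - a)

theorem concat_of_le {X : Type*} {a s : ℝ} (f g : ℝ → X) (h : s ≤ a) : concat a f g s = f s :=
  if_pos h

theorem concat_of_lt {X : Type*} {a s : ℝ} (f g : ℝ → X) (h : a < s) :
    concat a f g s = g (s - a) :=
  if_neg h.not_ge

theorem IsPWC.concat {q : ℕ} {a b : ℝ} {u v : ℝ → Fin q → ℝ} (hu : IsPWC a u) (hv : IsPWC b v) :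
    IsPWC (a + b) (concat a u v) := by
  classical
  obtain ⟨F, hF⟩ := hu
  obtain ⟨G, hG⟩ := hv
  -- The junction time `a` is itself a breakpoint, so two times that are not separated lie on the
  -- same side of it.
  refine ⟨insert a (F ∪ G.image (· + a)), fun x hx y hy hxy hd => ?_⟩
  rw [Set.disjoint_left] at hd
  have ha : ¬ (x ≤ a ∧ a ≤ y) := fun h => hd (a := a) ⟨h.1, h.2⟩ (by simp)
  rcases lt_or_ge y a with hya | hya
  · rw [concat_of_le _ _ hya.le, concat_of_le _ _ (hxy.trans hya.le)]
    refine hF x ⟨hx.1, by linarith⟩ y ⟨hy.1, hya⟩ hxy (Set.disjoint_left.2 fun z hz hzF => ?_)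
    exact hd hz (by simp [Finset.mem_coe.1 hzF])
  · have hxa : a < x := lt_of_not_ge fun h => ha ⟨h, hya⟩
    rw [concat_of_lt _ _ hxa, concat_of_lt _ _ (hxa.trans_le hxy)]
    refine hG _ ⟨by linarith, by linarith [hx.2]⟩ _ ⟨by linarith, by linarith [hy.2]⟩
      (by linarith) (Set.disjoint_left.2 fun z hz hzG => ?_)
    refine hd (a := z + a) ⟨by linarith [hz.1], by linarith [hz.2]⟩ ?_
    simp [Finset.mem_coe.1 hzG]

theorem IsSolution.apply_zero {q : ℕ} {α : ℝ} {Q : Fin q → C(Torus, ℝ)} {τ : ℝ}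
    {u : ℝ → Fin q → ℝ} {ψ₀ : L2C} {ψ : ℝ → L2C} (h : IsSolution α Q τ u ψ₀ ψ) (hτ : 0 ≤ τ) :
    ψ 0 = ψ₀ := by
  rw [h.duhamel 0 ⟨le_rfl, hτ⟩, intervalIntegral.integral_same, add_zero, freeFlow_zero]

/-- After time `a`, the group law pulls `e^{(t-a)L}` out of the free term and of the Duhamel
integral over `[0, a]`. Together they become `e^{(t-a)L} ψ(a)`, the free term of the second
solution; the rest of the integral is a time shift. -/
theorem IsSolution.concat {q : ℕ} {α : ℝ} {Q : Fin q → C(Torus, ℝ)} {a b : ℝ}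
    {u v : ℝ → Fin q → ℝ} {f : L2C} {ψ χ : ℝ → L2C} (ha : 0 ≤ a) (hb : 0 ≤ b)
    (hψ : IsSolution α Q a u f ψ) (hχ : IsSolution α Q b v (ψ a) χ) :
    IsSolution α Q (a + b) (concat a u v) f (concat a ψ χ) := by
  have hχ0 := hχ.apply_zero hb
  have hfirst : ∀ t s : ℝ, s ≤ a →
      freeFlow α (t - s) (potential Q (KdVSch.concat a u v s) (KdVSch.concat a ψ χ s)) =
        freeFlowIsometry α (t - a) (freeFlow α (a - s) (potential Q (u s) (ψ s))) := by
    intro t s hs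
    rw [concat_of_le _ _ hs, concat_of_le _ _ hs, freeFlowIsometry_apply, ← freeFlow_add,
      sub_add_sub_cancel]
  have hsecond : ∀ t s : ℝ, a < s →
      freeFlow α (t - s) (potential Q (KdVSch.concat a u v s) (KdVSch.concat a ψ χ s)) =
        freeFlow α (t - a - (s - a)) (potential Q (v (s - a)) (χ (s - a))) := by
    intro t s hs
    rw [concat_of_lt _ _ hs, concat_of_lt _ _ hs, sub_sub_sub_cancel_right]
  have hfirst' : ∀ t s : ℝ, s ≤ a →
      freeFlow α (t - s) (potential Q (KdVSch.concat a u v s) (KdVSch.concat a ψ χ s)) =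
        freeFlow α (t - s) (potential Q (u s) (ψ s)) := by
    intro t s hs
    rw [concat_of_le _ _ hs, concat_of_le _ _ hs]
  have hint1 : ∀ t, IntervalIntegrable (fun s : ℝ => freeFlow α (t - s)
      (potential Q (KdVSch.concat a u v s) (KdVSch.concat a ψ χ s))) volume 0 a := by
    intro t
    have h := hψ.integrable a ⟨ha, le_rfl⟩
    have h' : IntervalIntegrable (fun s => freeFlowIsometry α (t - a)
        (freeFlow α (a - s) (potential Q (u s) (ψ s)))) volume 0 a :=
      ⟨(freeFlowIsometry α (t - a)).toContinuousLinearMap.integrable_comp h.1,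
        (freeFlowIsometry α (t - a)).toContinuousLinearMap.integrable_comp h.2⟩
    refine h'.congr fun s hs => ?_
    rw [Set.uIoc_of_le ha] at hs
    exact (hfirst t s hs.2).symm
  have hint2 : ∀ t, a < t → t ≤ a + b → IntervalIntegrable (fun s : ℝ => freeFlow α (t - s)
      (potential Q (KdVSch.concat a u v s) (KdVSch.concat a ψ χ s))) volume a t := by
    intro t hat htb
    have h := (hχ.integrable (t - a) ⟨by linarith, by linarith⟩).comp_sub_right a
    rw [zero_add, sub_add_cancel] at h
    refine h.congr fun s hs => ?_
    rw [Set.uIoc_of_le hat.le] at hs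
    exact (hsecond t s hs.1).symm
  refine ⟨?_, fun t ht => ?_, fun t ht => ?_⟩
  · have h1 : ContinuousOn (KdVSch.concat a ψ χ) (Set.Icc 0 a) :=
      hψ.continuousOn.congr fun s hs => concat_of_le _ _ hs.2
    have h2 : ContinuousOn (KdVSch.concat a ψ χ) (Set.Icc a (a + b)) := by
      have : ContinuousOn (fun s => χ (s - a)) (Set.Icc a (a + b)) :=
        hχ.continuousOn.comp (by fun_prop) fun s hs => ⟨by linarith [hs.1], by linarith [hs.2]⟩
      refine this.congr fun s hs => ?_
      rcases hs.1.eq_or_lt with rfl | h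
      · simp only [concat_of_le _ _ le_rfl, sub_self, hχ0]
      · exact concat_of_lt _ _ h
    rw [← Set.Icc_union_Icc_eq_Icc ha (by linarith : a ≤ a + b)]
    exact h1.union_of_isClosed h2 isClosed_Icc isClosed_Icc
  · rcases le_or_gt t a with hta | hta
    · refine (hψ.integrable t ⟨ht.1, hta⟩).congr fun s hs => ?_
      rw [Set.uIoc_of_le ht.1] at hs
      exact (hfirst' t s (hs.2.trans hta)).symm
    · exact (hint1 t).trans (hint2 t hta ht.2)
  · rcases le_or_gt t a with hta | hta
    · rw [concat_of_le _ _ hta, hψ.duhamel t ⟨ht.1, hta⟩]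
      congr 1
      exact intervalIntegral.integral_congr_Ioo_of_le ht.1 fun s hs =>
        (hfirst' t s (hs.2.le.trans hta)).symm
    · rw [concat_of_lt _ _ hta, hχ.duhamel (t - a) ⟨by linarith, by linarith [ht.2]⟩,
        ← intervalIntegral.integral_add_adjacent_intervals (hint1 t) (hint2 t hta ht.2), ← add_assoc]
      congr 1
      · rw [intervalIntegral.integral_congr_Ioo_of_le (g := fun s =>
          (freeFlowIsometry α (t - a)).toContinuousLinearMap
            (freeFlow α (a - s) (potential Q (u s) (ψ s)))) ha fun s hs => hfirst t s hs.2.le,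
          ContinuousLinearMap.intervalIntegral_comp_comm _ (hψ.integrable a ⟨ha, le_rfl⟩),
          LinearIsometry.coe_toContinuousLinearMap, hψ.duhamel a ⟨ha, le_rfl⟩]
        nth_rewrite 2 [← sub_add_cancel t a]
        rw [freeFlow_add, ← freeFlowIsometry_apply, map_add]
        rfl
      · have h := intervalIntegral.integral_comp_sub_right (a := a) (b := t)
          (fun s => freeFlow α (t - a - s) (potential Q (v s) (χ s))) a
        rw [sub_self] at h
        rw [← h]
        exact intervalIntegral.integral_congr_Ioo_of_le hta.le fun s hs =>
          (hsecond t s hs.1).symm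

theorem isSolution_freeFlow {q : ℕ} (α : ℝ) (Q : Fin q → C(Torus, ℝ)) (τ : ℝ) (f : L2C) :
    IsSolution α Q τ 0 f fun t => freeFlow α t f := by
  have h : ∀ t : ℝ, (fun s : ℝ => freeFlow α (t - s)
      (potential Q ((0 : ℝ → Fin q → ℝ) s) (freeFlow α s f))) = fun _ => 0 := by
    intro t
    funext s
    rw [Pi.zero_apply, potential_zero, ← freeFlowIsometry_apply, map_zero]
  refine ⟨(continuous_freeFlow α f).continuousOn, fun t _ => ?_, fun t _ => ?_⟩
  · rw [h]
    exact intervalIntegrable_const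
  · rw [h, intervalIntegral.integral_zero, add_zero]

/-! ### Small-time reachability and the conjugation argument. -/

/-- The state `g` is reached exactly from `f` in time less than `T` by a piecewise constant
control. -/
def Reaches {q : ℕ} (α : ℝ) (Q : Fin q → C(Torus, ℝ)) (T : ℝ) (f g : L2C) : Prop :=
  ∃ τ ∈ Set.Ioo 0 T, ∃ u : ℝ → Fin q → ℝ, IsPWC τ u ∧ ∃ ψ : ℝ → L2C,
    IsSolution α Q τ u f ψ ∧ ψ τ = g

theorem Reaches.trans {q : ℕ} {α : ℝ} {Q : Fin q → C(Torus, ℝ)} {S T : ℝ} {f g h : L2C}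
    (hfg : Reaches α Q S f g) (hgh : Reaches α Q T g h) : Reaches α Q (S + T) f h := by
  obtain ⟨a, ha, u, hu, ψ, hψ, rfl⟩ := hfg
  obtain ⟨b, hb, v, hv, χ, hχ, rfl⟩ := hgh
  refine ⟨a + b, ⟨add_pos ha.1 hb.1, add_lt_add ha.2 hb.2⟩, concat a u v, hu.concat hv,
    concat a ψ χ, hψ.concat ha.1.le hb.1.le hχ, ?_⟩
  rw [concat_of_lt _ _ (by linarith [hb.1]), add_sub_cancel_left]

theorem reaches_freeFlow {q : ℕ} (α : ℝ) (Q : Fin q → C(Torus, ℝ)) {T τ : ℝ}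
    (hτ : τ ∈ Set.Ioo 0 T) (f : L2C) : Reaches α Q T f (freeFlow α τ f) :=
  ⟨τ, hτ, 0, ⟨∅, fun _ _ _ _ _ _ => rfl⟩, _, isSolution_freeFlow α Q τ f, rfl⟩

theorem mem_admissiblePhases_iff {q : ℕ} {α : ℝ} {Q : Fin q → C(Torus, ℝ)} {θ : L2R} :
    θ ∈ admissiblePhases α Q ↔ ∀ f : L2C, ∀ T > (0 : ℝ), ∀ ε > (0 : ℝ),
      ∃ g, Reaches α Q T f g ∧ ‖g - phaseMul θ f‖ ≤ ε := by
  constructor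
  · intro h f T hT ε hε
    obtain ⟨τ, hτ, u, hu, ψ, hψ, hle⟩ := h f T hT ε hε
    exact ⟨ψ τ, ⟨τ, hτ, u, hu, ψ, hψ, rfl⟩, hle⟩
  · intro h f T hT ε hε
    obtain ⟨g, ⟨τ, hτ, u, hu, ψ, hψ, rfl⟩, hle⟩ := h f T hT ε hε
    exact ⟨τ, hτ, u, hu, ψ, hψ, hle⟩

/-- If all multiples of `θ` are admissible and the free flow, conjugated by these phases, converges
strongly to the phase `χ` in small time, then `χ` is admissible. -/
theorem mem_admissiblePhases_of_tendsto {q : ℕ} {α : ℝ} {Q : Fin q → C(Torus, ℝ)} {θ χ : L2R}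
    (hθ : ∀ c : ℝ, c • θ ∈ admissiblePhases α Q)
    (hχ : ∀ f : L2C, Filter.Tendsto
      (fun m : ℝ => phaseMul (-(m⁻¹ • θ)) (freeFlow α (m ^ 3) (phaseMul (m⁻¹ • θ) f)))
      (nhdsWithin 0 (Set.Ioi 0)) (nhds (phaseMul χ f))) :
    χ ∈ admissiblePhases α Q := by
  rw [mem_admissiblePhases_iff]
  intro f T hT ε hε
  -- Each of the three stages (phase, free flow, inverse phase) gets a time budget of `T / 3`.
  have hsmall : ∀ᶠ m : ℝ in nhdsWithin 0 (Set.Ioi 0), m ^ 3 < T / 3 := by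
    have h : Filter.Tendsto (fun m : ℝ => m ^ 3) (nhdsWithin 0 (Set.Ioi 0)) (nhds 0) := by
      have : Continuous fun m : ℝ => m ^ 3 := by fun_prop
      simpa using (this.tendsto 0).mono_left nhdsWithin_le_nhds
    exact h.eventually_lt_const (by positivity)
  obtain ⟨m, ⟨hmT, hmε⟩, hm0⟩ := ((hsmall.and (Metric.tendsto_nhds.1 (hχ f) (ε / 3)
    (by positivity))).and self_mem_nhdsWithin).exists
  replace hm0 : 0 < m := hm0
  obtain ⟨g, hg, hgf⟩ := mem_admissiblePhases_iff.1 (hθ m⁻¹) f (T / 3) (by positivity) (ε / 3)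
    (by positivity)
  obtain ⟨k, hk, hkg⟩ := mem_admissiblePhases_iff.1 (hθ (-m⁻¹)) (freeFlow α (m ^ 3) g) (T / 3)
    (by positivity) (ε / 3) (by positivity)
  refine ⟨k, ?_, ?_⟩
  · have h := (hg.trans (reaches_freeFlow α Q ⟨by positivity, hmT⟩ g)).trans hk
    rwa [show T / 3 + T / 3 + T / 3 = T by ring] at h
  · rw [neg_smul] at hkg
    have h1 : ‖phaseMul (-(m⁻¹ • θ)) (freeFlow α (m ^ 3) g) -
        phaseMul (-(m⁻¹ • θ)) (freeFlow α (m ^ 3) (phaseMul (m⁻¹ • θ) f))‖ ≤ ε / 3 := by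
      simp only [← phaseIsometry_apply, ← freeFlowIsometry_apply, ← map_sub,
        LinearIsometry.norm_map] at hgf ⊢
      exact hgf
    rw [dist_eq_norm] at hmε
    calc _ = ‖(k - phaseMul (-(m⁻¹ • θ)) (freeFlow α (m ^ 3) g)) +
          (phaseMul (-(m⁻¹ • θ)) (freeFlow α (m ^ 3) g) -
            phaseMul (-(m⁻¹ • θ)) (freeFlow α (m ^ 3) (phaseMul (m⁻¹ • θ) f))) +
          (phaseMul (-(m⁻¹ • θ)) (freeFlow α (m ^ 3) (phaseMul (m⁻¹ • θ) f)) -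
            phaseMul χ f)‖ := by congr 1; abel
      _ ≤ ε / 3 + ε / 3 + ε / 3 :=
        norm_add₃_le.trans (add_le_add (add_le_add hkg h1) hmε.le)
      _ = ε := by ring

/-! ### Differentiation on the torus and Fourier coefficients. -/

/-- `F'` is the derivative of the function `F` on the torus. -/
def HasTorusDeriv {E : Type*} [NormedAddCommGroup E] [NormedSpace ℝ E] (F F' : C(Torus, E)) :
    Prop :=
  ∀ x : ℝ, HasDerivAt (fun y : ℝ => F (y : Torus)) (F' (x : Torus)) x

theorem HasTorusDeriv.mul {F F' G G' : C(Torus, ℂ)} (hF : HasTorusDeriv F F')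
    (hG : HasTorusDeriv G G') : HasTorusDeriv (F * G) (F' * G + F * G') :=
  fun x => (hF x).mul (hG x)

theorem HasTorusDeriv.add {F F' G G' : C(Torus, ℂ)} (hF : HasTorusDeriv F F')
    (hG : HasTorusDeriv G G') : HasTorusDeriv (F + G) (F' + G') :=
  fun x => (hF x).add (hG x)

theorem HasTorusDeriv.const_smul {F F' : C(Torus, ℂ)} (c : ℂ) (hF : HasTorusDeriv F F') :
    HasTorusDeriv (c • F) (c • F') :=
  fun x => (hF x).const_smul c

/-- A real continuous function, seen as a complex one. -/
def toComplex (θ : C(Torus, ℝ)) : C(Torus, ℂ) where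
  toFun x := (θ x : ℂ)

theorem toComplex_apply (θ : C(Torus, ℝ)) (x : Torus) : toComplex θ x = (θ x : ℂ) := rfl

theorem HasTorusDeriv.toComplex {θ θ' : C(Torus, ℝ)} (h : HasTorusDeriv θ θ') :
    HasTorusDeriv (toComplex θ) (toComplex θ') :=
  fun x => (h x).ofReal_comp

theorem HasTorusDeriv.expPhase {θ θ' : C(Torus, ℝ)} (h : HasTorusDeriv θ θ') :
    HasTorusDeriv (expPhase θ) (Complex.I • (KdVSch.toComplex θ' * expPhase θ)) := by
  intro x
  have h1 := ((h.toComplex x).const_mul Complex.I).cexp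
  refine h1.congr_deriv ?_
  simp only [ContinuousMap.smul_apply, ContinuousMap.mul_apply, expPhase_apply, toComplex_apply,
    smul_eq_mul]
  ring

theorem hasTorusDeriv_fourier (k : ℤ) :
    HasTorusDeriv (fourier k : C(Torus, ℂ)) (Complex.I • ((k : ℂ) • fourier k)) := by
  intro x
  refine (hasDerivAt_fourier (2 * Real.pi) k x).congr_deriv ?_
  have : (Real.pi : ℂ) ≠ 0 := by exact_mod_cast Real.pi_ne_zero
  simp only [ContinuousMap.smul_apply, smul_eq_mul]
  push_cast
  field_simp

theorem continuous_torus_iff {E : Type*} [TopologicalSpace E] {f : Torus → E} :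
    Continuous f ↔ Continuous fun x : ℝ => f (x : Torus) :=
  (QuotientAddGroup.isQuotientMap_mk _).continuous_iff

theorem torusDeriv_coe (f : Torus → ℝ) (x : ℝ) :
    torusDeriv f (x : Torus) = deriv (fun y : ℝ => f (y : Torus)) x := by
  have h := deriv_comp_const_add (f := fun y : ℝ => f (y : Torus)) x 0
  rw [add_zero] at h
  rw [← h, torusDeriv]
  simp only [coe_add]

theorem exists_hasTorusDeriv {θ : C(Torus, ℝ)} {n : ℕ}
    (h : ContDiff ℝ (n + 1) fun x : ℝ => θ (x : Torus)) :
    ∃ θ' : C(Torus, ℝ), HasTorusDeriv θ θ' ∧ (ContDiff ℝ n fun x : ℝ => θ' (x : Torus)) ∧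
      ∀ x, θ' x = torusDeriv θ x := by
  have hd : ContDiff ℝ n (deriv fun x : ℝ => θ (x : Torus)) := (contDiff_succ_iff_deriv.1 h).2.2
  have heq : (fun x : ℝ => torusDeriv θ (x : Torus)) = deriv fun x : ℝ => θ (x : Torus) :=
    funext (torusDeriv_coe θ)
  refine ⟨⟨torusDeriv θ, continuous_torus_iff.2 (heq ▸ hd.continuous)⟩, fun x => ?_, ?_,
    fun _ => rfl⟩
  · refine HasDerivAt.congr_deriv ?_ (torusDeriv_coe θ x).symm
    exact ((h.differentiable (by simp)) x).hasDerivAt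
  · exact heq.symm ▸ hd

theorem repr_toL2C (F : C(Torus, ℂ)) (k : ℤ) :
    fourierBasis.repr (toL2C F) k = fourierCoeff F k := by
  rw [fourierBasis_repr, fourierCoeff_toLp]

theorem HasTorusDeriv.fourierCoeff_zero {F F' : C(Torus, ℂ)} (h : HasTorusDeriv F F') :
    fourierCoeff F' 0 = 0 := by
  rw [fourierCoeff_eq_intervalIntegral _ _ 0]
  simp only [neg_zero, fourier_zero, one_smul]
  rw [intervalIntegral.integral_eq_sub_of_hasDerivAt (fun x _ => h x), coe_add_period, sub_self,
    smul_zero]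
  exact (F'.continuous.comp (AddCircle.continuous_mk' _)).intervalIntegrable _ _

theorem fourierCoeff_fourier_mul (F : C(Torus, ℂ)) (k : ℤ) :
    fourierCoeff (fourier (-k) * F : C(Torus, ℂ)) 0 = fourierCoeff F k := by
  simp [fourierCoeff]

/-- Integration by parts: `(e_{-k} F)'` has zero mean by periodicity. -/
theorem HasTorusDeriv.repr_toL2C {F F' : C(Torus, ℂ)} (h : HasTorusDeriv F F') (k : ℤ) :
    fourierBasis.repr (toL2C F') k = Complex.I * k * fourierBasis.repr (toL2C F) k := by
  have h1 := ((hasTorusDeriv_fourier (-k)).mul h).fourierCoeff_zero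
  rw [← KdVSch.repr_toL2C, smul_mul_assoc, smul_mul_assoc, map_add, map_add, map_smul, map_smul,
    map_smul, map_smul, lp.coeFn_add, Pi.add_apply, lp.coeFn_smul, Pi.smul_apply, lp.coeFn_smul,
    Pi.smul_apply, KdVSch.repr_toL2C, KdVSch.repr_toL2C, fourierCoeff_fourier_mul,
    fourierCoeff_fourier_mul] at h1
  rw [KdVSch.repr_toL2C, KdVSch.repr_toL2C]
  simp only [smul_eq_mul] at h1
  push_cast at h1
  linear_combination h1

/-- In the Banach algebra `C(𝕋, ℂ)` the function `e^{isw}` is the exponential of `s · iw`, which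
gives differentiability in the uniform norm, hence in `L²`. -/
theorem hasDerivAt_expPhase_smul (w : C(Torus, ℝ)) (s : ℝ) :
    HasDerivAt (fun s : ℝ => expPhase (s • w))
      (Complex.I • (toComplex w * expPhase (s • w))) s := by
  have hexp : ∀ s : ℝ, expPhase (s • w) = NormedSpace.exp (s • (Complex.I • toComplex w)) := by
    intro s
    ext x
    have h := NormedSpace.map_exp (ContinuousMap.evalAlgHom ℂ ℂ x)
      (continuous_eval_const x) (s • (Complex.I • toComplex w))
    rw [ContinuousMap.evalAlgHom_apply] at h
    rw [h, ← Complex.exp_eq_exp_ℂ, expPhase_apply]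
    simp [toComplex_apply]
    ring_nf
  simp_rw [hexp]
  rw [← smul_mul_assoc]
  exact hasDerivAt_exp_smul_const' (𝕂 := ℝ) (Complex.I • toComplex w) s

/-! ### Stability of the free flow under a small defect. -/

/-- The symbol of `L = -∂ₓ³ + i α ∂ₓ²` at the frequency `k`. -/
def generatorSymbol (α : ℝ) (k : ℤ) : ℂ :=
  -(Complex.I * k) ^ 3 + Complex.I * α * (Complex.I * k) ^ 2

theorem hasDerivAt_symbol_neg_mul (α δ : ℝ) (k : ℤ) (s : ℝ) :
    HasDerivAt (fun s : ℝ => symbol α (-(s * δ)) k)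
      (symbol α (-(s * δ)) k * (-δ * generatorSymbol α k)) s := by
  have h : HasDerivAt (fun s : ℝ => ((-(s * δ) : ℝ) : ℂ)) ((-(1 * δ) : ℝ) : ℂ) s :=
    ((hasDerivAt_id s).mul_const δ).neg.ofReal_comp
  refine (h.mul_const (generatorSymbol α k)).cexp.congr_deriv ?_
  rw [symbol, generatorSymbol]
  push_cast
  ring

/-- If the path `g` in `L²` solves `g' = δ L g` up to an error at most `C`, where `h` is the value
of `L g`, then `g 1` is within `C` of the free flow, at time `δ`, from `g 0`. -/
theorem norm_freeFlow_neg_sub_le {α δ C : ℝ} {g g' h : ℝ → L2C}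
    (hg : ∀ s, HasDerivAt g (g' s) s)
    (hh : ∀ s, ∀ k : ℤ, fourierBasis.repr (h s) k =
      generatorSymbol α k * fourierBasis.repr (g s) k)
    (hC : ∀ s ∈ Set.Icc (0 : ℝ) 1, ‖g' s - (δ : ℂ) • h s‖ ≤ C) :
    ‖freeFlow α (-δ) (g 1) - g 0‖ ≤ C := by
  -- As `L` is unbounded, `e^{-sδL} g(s)` is differentiated only weakly, against trigonometric
  -- polynomials. Each Fourier coefficient obeys the scalar product rule, and the term `-δL` from
  -- the group turns `g'` into the defect `g' - δLg`.
  have hderiv : ∀ v ∈ Submodule.span ℂ (Set.range fun k : ℤ => (fourierBasis k : L2C)), ∀ s : ℝ,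
      HasDerivAt (fun s : ℝ => inner ℂ v (freeFlow α (-(s * δ)) (g s)))
        (inner ℂ v (freeFlow α (-(s * δ)) (g' s - (δ : ℂ) • h s))) s := by
    intro v hv s
    induction hv using Submodule.span_induction with
    | mem x hx =>
      obtain ⟨k, rfl⟩ := hx
      simp only [← HilbertBasis.repr_apply_apply, repr_freeFlow]
      have h1 : HasDerivAt (fun s => fourierBasis.repr (g s) k) (fourierBasis.repr (g' s) k) s := by
        simp only [HilbertBasis.repr_apply_apply]
        exact ((innerSL ℂ (fourierBasis k : L2C)).restrictScalars ℝ).hasFDerivAt.comp_hasDerivAt s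
          (hg s)
      refine ((hasDerivAt_symbol_neg_mul α δ k s).mul h1).congr_deriv ?_
      rw [map_sub, map_smul, lp.coeFn_sub, Pi.sub_apply, lp.coeFn_smul, Pi.smul_apply, hh,
        smul_eq_mul]
      ring
    | zero => simpa using hasDerivAt_const s (0 : ℂ)
    | add x y _ _ hx hy =>
      simp only [inner_add_left]
      exact hx.add hy
    | smul c x _ hx => simpa only [inner_smul_left] using hx.const_mul _
  set D := freeFlow α (-δ) (g 1) - g 0 with hD
  have hbound : ∀ v ∈ (Submodule.span ℂ (Set.range fun k : ℤ => (fourierBasis k : L2C)) : Set L2C),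
      ‖inner ℂ v D‖ ≤ ‖v‖ * C := by
    intro v hv
    have h1 := norm_image_sub_le_of_norm_deriv_le_segment_01' (C := ‖v‖ * C)
      (fun s _ => (hderiv v hv s).hasDerivWithinAt) fun s hs => by
        refine (norm_inner_le_norm _ _).trans ?_
        rw [norm_freeFlow]
        exact mul_le_mul_of_nonneg_left (hC s (Set.Ico_subset_Icc_self hs)) (norm_nonneg _)
    simpa [freeFlow_zero, ← inner_sub_right] using h1
  have hclosed : IsClosed {v : L2C | ‖inner ℂ v D‖ ≤ ‖v‖ * C} :=
    isClosed_le (by fun_prop) (by fun_prop)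
  have hDmem : D ∈ closure
      (Submodule.span ℂ (Set.range fun k : ℤ => (fourierBasis k : L2C)) : Set L2C) := by
    rw [← Submodule.topologicalClosure_coe, fourierBasis.dense_span]
    trivial
  -- By density the bound extends to the test vector `v = D`, giving `‖D‖² ≤ ‖D‖ C`.
  have hDD : ‖inner ℂ D D‖ ≤ ‖D‖ * C := closure_minimal hbound hclosed hDmem
  rw [inner_self_eq_norm_sq_to_K, norm_pow, RCLike.norm_ofReal, abs_of_nonneg (norm_nonneg _),
    pow_two] at hDD
  rcases (norm_nonneg D).eq_or_lt with h0 | h0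
  · rw [← h0]
    exact (norm_nonneg _).trans (hC 0 (by simp))
  · exact le_of_mul_le_mul_left hDD h0

/-! ### The approximate solution and its defect. -/

/-- Trigonometric polynomials, hence smooth functions, are uniformly dense. -/
theorem exists_contDiff_near (χ : C(Torus, ℝ)) (n : ℕ) {ε : ℝ} (hε : 0 < ε) :
    ∃ w : C(Torus, ℝ), (ContDiff ℝ n fun x : ℝ => w (x : Torus)) ∧ ∀ x, |w x - χ x| < ε := by
  have hsmooth : ∀ p ∈ Submodule.span ℂ (Set.range (fourier : ℤ → C(Torus, ℂ))),
      ContDiff ℝ n fun x : ℝ => p (x : Torus) := by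
    intro p hp
    induction hp using Submodule.span_induction with
    | mem x hx =>
      obtain ⟨k, rfl⟩ := hx
      simp only [fourier_coe_apply]
      have h : ContDiff ℝ n fun x : ℝ => (x : ℂ) := Complex.ofRealCLM.contDiff
      exact ((contDiff_const.mul h).div_const _).cexp
    | zero => exact contDiff_const
    | add x y _ _ hx hy => exact hx.add hy
    | smul c x _ hx => exact hx.const_smul c
  have hmem : toComplex χ ∈ closure
      (Submodule.span ℂ (Set.range (fourier : ℤ → C(Torus, ℂ))) : Set C(Torus, ℂ)) := by
    rw [← Submodule.topologicalClosure_coe, span_fourier_closure_eq_top]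
    trivial
  obtain ⟨p, hp, hd⟩ := Metric.mem_closure_iff.1 hmem ε hε
  refine ⟨⟨fun x => (p x).re, by fun_prop⟩, Complex.reCLM.contDiff.comp (hsmooth p hp), fun x => ?_⟩
  have h1 : ‖p x - toComplex χ x‖ < ε := by
    rw [← dist_eq_norm, dist_comm]
    exact (ContinuousMap.dist_apply_le_dist x).trans_lt hd
  refine lt_of_le_of_lt ?_ h1
  have h2 := Complex.abs_re_le_norm (p x - toComplex χ x)
  simpa [toComplex_apply] using h2

/-- The action of `L` on a function `G` with `G' = i a G`, in terms of the successive derivatives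
`a`, `b`, `c` of the phase. -/
theorem repr_toL2C_generator {α : ℝ} {G a b c : C(Torus, ℂ)}
    (hG : HasTorusDeriv G (Complex.I • (a * G))) (ha : HasTorusDeriv a b)
    (hb : HasTorusDeriv b c) (k : ℤ) :
    fourierBasis.repr (toL2C ((-(Complex.I • c) + (3 : ℂ) • (a * b) + Complex.I • a ^ 3
        - (α : ℂ) • b - (Complex.I * α) • a ^ 2) * G)) k =
      generatorSymbol α k * fourierBasis.repr (toL2C G) k := by
  -- The product rule gives `G''` and then `G'''`, which involve the phase only through its first
  -- three derivatives.
  have h2 := (ha.mul hG).const_smul Complex.I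
  have h3 := ((hb.mul hG).add (ha.mul h2)).const_smul Complex.I
  have heq : (-(Complex.I • c) + (3 : ℂ) • (a * b) + Complex.I • a ^ 3
        - (α : ℂ) • b - (Complex.I * α) • a ^ 2) * G =
      -(Complex.I • (c * G + b * Complex.I • (a * G) + (b * Complex.I • (a * G) +
        a * Complex.I • (b * G + a * Complex.I • (a * G))))) +
      (Complex.I * α) • (Complex.I • (b * G + a * Complex.I • (a * G))) := by
    ext x
    simp only [ContinuousMap.mul_apply, ContinuousMap.add_apply, ContinuousMap.sub_apply,
      ContinuousMap.neg_apply, ContinuousMap.smul_apply, ContinuousMap.pow_apply, smul_eq_mul]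
    linear_combination (3 * a x * b x * G x + Complex.I * a x ^ 3 * G x - α * b x * G x
      - Complex.I * α * a x ^ 2 * G x) * Complex.I_sq
  rw [heq, map_add, map_add, map_neg, map_neg, map_smul toL2C (Complex.I * α),
    map_smul fourierBasis.repr (Complex.I * α), lp.coeFn_add, Pi.add_apply,
    lp.coeFn_neg, Pi.neg_apply, lp.coeFn_smul, Pi.smul_apply, h3.repr_toL2C, h2.repr_toL2C,
    hG.repr_toL2C, generatorSymbol, smul_eq_mul]
  ring

/-- The defect, divided by its phase factor, of `exp (i (φ / m + s w)) exp (i k x)` as a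
solution on `[0, 1]` of `∂ₛψ = m³ L ψ`; here `p₁, p₂, p₃` and `w₁, w₂, w₃` are the derivatives of
`φ` and `w`. -/
def defect (α : ℝ) (p₁ p₂ p₃ w w₁ w₂ w₃ k m s : ℝ) : ℂ :=
  Complex.I * w + Complex.I * m ^ 2 * (p₃ + m * s * w₃)
    - 3 * m * (p₁ + m * (s * w₁ + k)) * (p₂ + m * s * w₂)
    - Complex.I * (p₁ + m * (s * w₁ + k)) ^ 3 + α * m ^ 2 * (p₂ + m * s * w₂)
    + Complex.I * α * m * (p₁ + m * (s * w₁ + k)) ^ 2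

/-- At `m = 0` the defect is `i(w - p₁³)`, of modulus less than `ε`. The bound persists for small
`m`, uniformly in `(s, x)`, by compactness of `[0, 1] × 𝕋`. -/
theorem eventually_norm_defect_le (α : ℝ) (p₁ p₂ p₃ w w₁ w₂ w₃ : C(Torus, ℝ)) (k : ℝ) {ε : ℝ}
    (h : ∀ x, |w x - p₁ x ^ 3| < ε) :
    ∀ᶠ m : ℝ in nhds 0, ∀ s ∈ Set.Icc (0 : ℝ) 1, ∀ x,
      ‖defect α (p₁ x) (p₂ x) (p₃ x) (w x) (w₁ x) (w₂ x) (w₃ x) k m s‖ < ε := by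
  have hK : IsCompact (Set.Icc (0 : ℝ) 1 ×ˢ (Set.univ : Set Torus)) :=
    isCompact_Icc.prod isCompact_univ
  have hcont : Continuous fun z : ℝ × ℝ × Torus => ‖defect α (p₁ z.2.2) (p₂ z.2.2) (p₃ z.2.2)
      (w z.2.2) (w₁ z.2.2) (w₂ z.2.2) (w₃ z.2.2) k z.1 z.2.1‖ := by
    unfold defect
    fun_prop
  have hev := hK.eventually_forall_of_forall_eventually (x₀ := (0 : ℝ))
    (P := fun m y => ‖defect α (p₁ y.2) (p₂ y.2) (p₃ y.2) (w y.2) (w₁ y.2) (w₂ y.2) (w₃ y.2) k m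
      y.1‖ < ε) fun y _ => by
    refine (hcont.tendsto (0, y)).eventually_lt_const ?_
    have h0 : defect α (p₁ y.2) (p₂ y.2) (p₃ y.2) (w y.2) (w₁ y.2) (w₂ y.2) (w₃ y.2) k 0 y.1 =
        Complex.I * ((w y.2 - p₁ y.2 ^ 3 : ℝ) : ℂ) := by
      rw [defect]
      push_cast
      ring
    simpa only [h0, norm_mul, Complex.norm_I, one_mul, Complex.norm_real, Real.norm_eq_abs]
      using h y.2
  filter_upwards [hev] with m hm s hs x
  exact hm (s, x) ⟨hs, trivial⟩

/-- Conjugating the free flow at time `m³` by the phase `φ / m` produces the phase `w`, up to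
the defect. -/
theorem norm_freeFlow_phase_sub_le {α m ε : ℝ} (hm : 0 < m) (k : ℤ)
    {φ p₁ p₂ p₃ w w₁ w₂ w₃ : C(Torus, ℝ)} (hφ : HasTorusDeriv φ p₁) (hp₁ : HasTorusDeriv p₁ p₂)
    (hp₂ : HasTorusDeriv p₂ p₃) (hw : HasTorusDeriv w w₁) (hw₁ : HasTorusDeriv w₁ w₂)
    (hw₂ : HasTorusDeriv w₂ w₃)
    (hε : ∀ s ∈ Set.Icc (0 : ℝ) 1, ∀ x,
      ‖defect α (p₁ x) (p₂ x) (p₃ x) (w x) (w₁ x) (w₂ x) (w₃ x) k m s‖ ≤ ε) :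
    ‖freeFlow α (-m ^ 3) (toL2C (expPhase w * (expPhase (m⁻¹ • φ) * fourier k))) -
      toL2C (expPhase (m⁻¹ • φ) * fourier k)‖ ≤ ε := by
  have hsmul : ∀ {θ θ' : C(Torus, ℝ)} (c : ℝ), HasTorusDeriv θ θ' →
      HasTorusDeriv (c • θ) (c • θ') := fun c h x => (h x).const_smul c
  set G : ℝ → C(Torus, ℂ) := fun s => expPhase (s • w) * (expPhase (m⁻¹ • φ) * fourier k) with hGdef
  -- `a`, `b`, `c` are the successive derivatives of the total phase `s w + φ/m + kx`; the frequency
  -- `k` only enters the first.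
  set a : ℝ → C(Torus, ℂ) := fun s => toComplex (s • w₁) + (toComplex (m⁻¹ • p₁) +
    (k : ℂ) • (1 : C(Torus, ℂ))) with ha
  set b : ℝ → C(Torus, ℂ) := fun s => toComplex (s • w₂) + toComplex (m⁻¹ • p₂) with hb
  set c : ℝ → C(Torus, ℂ) := fun s => toComplex (s • w₃) + toComplex (m⁻¹ • p₃) with hc
  have hconst : HasTorusDeriv ((k : ℂ) • (1 : C(Torus, ℂ))) 0 := fun x => hasDerivAt_const x ((k : ℂ) • (1 : ℂ))
  have hG1 : ∀ s, HasTorusDeriv (G s) (Complex.I • (a s * G s)) := by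
    intro s
    have h := (hsmul s hw).expPhase.mul
      ((hsmul m⁻¹ hφ).expPhase.mul (hasTorusDeriv_fourier k))
    convert h using 1
    simp only [ha, hGdef, smul_mul_assoc, mul_smul_comm, one_mul, add_mul, mul_add, smul_add,
      smul_smul]
    ring_nf
  have ha1 : ∀ s, HasTorusDeriv (a s) (b s) := by
    intro s
    have h := (hsmul s hw₁).toComplex.add ((hsmul m⁻¹ hp₁).toComplex.add hconst)
    rwa [add_zero] at h
  have hb1 : ∀ s, HasTorusDeriv (b s) (c s) := fun s =>
    (hsmul s hw₂).toComplex.add (hsmul m⁻¹ hp₂).toComplex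
  have hG : ∀ s, HasDerivAt G (Complex.I • (toComplex w * G s)) s := by
    intro s
    refine ((hasDerivAt_expPhase_smul w s).mul_const _).congr_deriv ?_
    rw [hGdef, smul_mul_assoc, mul_assoc]
  have hgL2 : ∀ s, HasDerivAt (fun s => toL2C (G s)) (toL2C (Complex.I • (toComplex w * G s))) s :=
    fun s => (toL2C.restrictScalars ℝ).hasFDerivAt.comp_hasDerivAt s (hG s)
  have key := norm_freeFlow_neg_sub_le (α := α) (δ := m ^ 3) (C := ε) hgL2
    (fun s k => repr_toL2C_generator (hG1 s) (ha1 s) (hb1 s) k) fun s hs => by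
      rw [← map_smul, ← map_sub]
      refine norm_toL2C_le fun x => ?_
      refine le_of_eq_of_le ?_ (hε s hs x)
      have hm' : (m : ℂ) ≠ 0 := by exact_mod_cast hm.ne'
      have hGx : ‖G s x‖ = 1 := by
        simp only [hGdef, ContinuousMap.mul_apply, norm_mul, norm_expPhase_apply, one_mul]
        exact Circle.norm_coe _
      -- Since `|G| = 1`, the defect may be multiplied back by `G` and compared with `iwG - m³LG`
      -- pointwise.
      rw [← mul_one ‖defect _ _ _ _ _ _ _ _ _ _ _‖, ← hGx, ← norm_mul]
      congr 1
      simp only [ha, hb, hc, ContinuousMap.mul_apply, ContinuousMap.add_apply,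
        ContinuousMap.sub_apply, ContinuousMap.neg_apply, ContinuousMap.smul_apply,
        ContinuousMap.pow_apply, smul_eq_mul, toComplex_apply, ContinuousMap.one_apply, defect]
      push_cast
      field_simp
      ring
  simpa only [hGdef, one_smul, zero_smul, expPhase_zero, one_mul] using key

theorem norm_expPhase_sub_le (θ χ : C(Torus, ℝ)) (x : Torus) :
    ‖expPhase θ x - expPhase χ x‖ ≤ |θ x - χ x| := by
  have h : expPhase θ x - expPhase χ x =
      expPhase χ x * (Complex.exp (Complex.I * ((θ x - χ x : ℝ) : ℂ)) - 1) := by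
    rw [mul_sub, mul_one, expPhase_apply, expPhase_apply, ← Complex.exp_add]
    push_cast
    ring_nf
  rw [h, norm_mul, norm_expPhase_apply, one_mul]
  exact Real.norm_exp_I_mul_ofReal_sub_one_le

/-- This is the strong limit `e^{-iφ/m} e^{m³L} e^{iφ/m} → e^{i(φ')³}`, reduced to the Fourier
basis. -/
theorem tendsto_phase_freeFlow_phase (α : ℝ) {φ p₁ p₂ p₃ : C(Torus, ℝ)}
    (hφ : HasTorusDeriv φ p₁) (hp₁ : HasTorusDeriv p₁ p₂) (hp₂ : HasTorusDeriv p₂ p₃) (f : L2C) :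
    Filter.Tendsto (fun m : ℝ => phaseMul (-(m⁻¹ • toL2R φ))
        (freeFlow α (m ^ 3) (phaseMul (m⁻¹ • toL2R φ) f)))
      (nhdsWithin 0 (Set.Ioi 0)) (nhds (phaseMul (toL2R (p₁ ^ 3)) f)) := by
  refine tendsto_isometry_of_fourierBasis
    (fun m => (phaseIsometry (-(m⁻¹ • toL2R φ))).comp
      ((freeFlowIsometry α (m ^ 3)).comp (phaseIsometry (m⁻¹ • toL2R φ))))
    (phaseIsometry (toL2R (p₁ ^ 3))) (fun k => ?_) f
  have hbasis : (fourierBasis k : L2C) = toL2C (fourier k) := by rw [coe_fourierBasis]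
  change Filter.Tendsto (fun m : ℝ => phaseMul (-(m⁻¹ • toL2R φ))
        (freeFlow α (m ^ 3) (phaseMul (m⁻¹ • toL2R φ) (fourierBasis k))))
      (nhdsWithin 0 (Set.Ioi 0)) (nhds (phaseMul (toL2R (p₁ ^ 3)) (fourierBasis k)))
  rw [hbasis]
  rw [Metric.tendsto_nhds]
  intro ε hε
  -- The target `p₁³` need only be `C²`, while `L` takes three derivatives, so it is replaced by a
  -- smooth `w`. The replacement and the defect cost `ε / 4` each, which leaves a strict inequality.
  obtain ⟨w, hw, hwp⟩ := exists_contDiff_near (p₁ ^ 3) 3 (half_pos (half_pos hε))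
  obtain ⟨w₁, hw₁, hw₁', -⟩ := exists_hasTorusDeriv (n := 2) (by exact_mod_cast hw)
  obtain ⟨w₂, hw₂, hw₂', -⟩ := exists_hasTorusDeriv (n := 1) (by exact_mod_cast hw₁')
  obtain ⟨w₃, hw₃, -, -⟩ := exists_hasTorusDeriv (n := 0) (by exact_mod_cast hw₂')
  filter_upwards [nhdsWithin_le_nhds (eventually_norm_defect_le α p₁ p₂ p₃ w w₁ w₂ w₃ k hwp),
    self_mem_nhdsWithin] with m hm hm0
  have h1 := norm_freeFlow_phase_sub_le (α := α) hm0 k hφ hp₁ hp₂ hw₁ hw₂ hw₃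
    fun s hs x => (hm s hs x).le
  have h2 : ‖toL2C (expPhase w * fourier k) - toL2C (expPhase (p₁ ^ 3) * fourier k)‖ ≤
      ε / 2 / 2 := by
    rw [← map_sub]
    refine norm_toL2C_le fun x => ?_
    rw [← sub_mul, ContinuousMap.mul_apply, norm_mul,
      show ‖(fourier k : C(Torus, ℂ)) x‖ = 1 from Circle.norm_coe _, mul_one]
    exact (norm_expPhase_sub_le w (p₁ ^ 3) x).trans (hwp x).le
  have h3 : dist (phaseMul (-(m⁻¹ • toL2R φ))
      (freeFlow α (m ^ 3) (phaseMul (m⁻¹ • toL2R φ) (toL2C (fourier k)))))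
      (toL2C (expPhase w * fourier k)) ≤ ε / 2 / 2 := by
    -- Apply the isometries `e^{iφ/m}` and then `e^{-m³L}` to both sides: what remains is the
    -- distance from `e^{-m³L} G(1)` to `G(0)`.
    rw [← phaseMul_neg_phaseMul (m⁻¹ • toL2R φ) (toL2C (expPhase w * fourier k)),
      ← phaseIsometry_apply (-_), ← phaseIsometry_apply (-_), LinearIsometry.dist_map,
      ← map_smul, phaseMul_toL2R, phaseMul_toL2R,
      ← (freeFlowIsometry α (-m ^ 3)).dist_map, freeFlowIsometry_apply, ← freeFlow_add,
      neg_add_cancel, freeFlow_zero, dist_comm, dist_eq_norm, freeFlowIsometry_apply, mul_left_comm]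
    exact h1
  rw [phaseMul_toL2R]
  rw [← dist_eq_norm] at h2
  linarith [dist_triangle (phaseMul (-(m⁻¹ • toL2R φ))
      (freeFlow α (m ^ 3) (phaseMul (m⁻¹ • toL2R φ) (toL2C (fourier k)))))
      (toL2C (expPhase w * fourier k)) (toL2C (expPhase (p₁ ^ 3) * fourier k))]

end KdVSch

end

theorem proposition3p3 {q : ℕ} (α : ℝ) (Q : Fin q → C(KdVSch.Torus, ℝ))
    (φ : C(KdVSch.Torus, ℝ)) (hφ : ContDiff ℝ 3 (fun x : ℝ => φ (x : KdVSch.Torus)))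
    (hspan : (Submodule.span ℝ {ContinuousMap.toLp 2 haarAddCircle ℝ φ} : Set KdVSch.L2R) ⊆
      KdVSch.admissiblePhases α Q) :
    ∃ h : MemLp (fun x : KdVSch.Torus => KdVSch.torusDeriv φ x ^ 3) 2 haarAddCircle,
      h.toLp _ ∈ KdVSch.admissiblePhases α Q := by
  obtain ⟨p₁, h₁, h₁', hp₁⟩ := KdVSch.exists_hasTorusDeriv (n := 2) (by exact_mod_cast hφ)
  obtain ⟨p₂, h₂, h₂', -⟩ := KdVSch.exists_hasTorusDeriv (n := 1) (by exact_mod_cast h₁')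
  obtain ⟨p₃, h₃, -, -⟩ := KdVSch.exists_hasTorusDeriv (n := 0) (by exact_mod_cast h₂')
  have heq : KdVSch.toL2R (p₁ ^ 3) =ᵐ[haarAddCircle]
      fun x : KdVSch.Torus => KdVSch.torusDeriv φ x ^ 3 := by
    filter_upwards [ContinuousMap.coeFn_toLp (p := 2) (𝕜 := ℝ) haarAddCircle (p₁ ^ 3)] with x hx
    rw [hx, ContinuousMap.pow_apply, hp₁]
  have hmem := (Lp.memLp (KdVSch.toL2R (p₁ ^ 3))).ae_eq heq
  refine ⟨hmem, ?_⟩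
  rw [MemLp.toLp_congr hmem (Lp.memLp _) heq.symm, Lp.toLp_coeFn]
  exact KdVSch.mem_admissiblePhases_of_tendsto
    (fun c => hspan (Submodule.smul_mem _ c (Submodule.mem_span_singleton_self _)))
    (KdVSch.tendsto_phase_freeFlow_phase α h₁ h₂ h₃)
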